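/- Let $P$ be a finite partially ordered set. For $k \ge 0$ let $d_k(P)$ denote the largest size of a $k$-antichain of $P$, that is, of a subset of $P$ which can be decomposed into $k$ (possibly empty) pairwise disjoint antichains. If $P$ has width at most $3$ (every antichain of $P$ has at most $3$ elements), then $P$ is $d$-decomposable: there is a partition of $P$ into nonempty antichains $A_1, A_2, \ldots, A_h$ such that $$\Bigl|\bigcup_{1 \le i \le \min(k,h)} A_i\Bigr| = d_k(P) \quad\text{for every integer } k \ge 0.$$ -/

import Mathlib

/-- A subset of a poset is a `k`-antichain if it can be decomposed into `k` pairwise disjoint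
antichains (some of which may be empty). -/
def IsKAntichain {P : Type*} [PartialOrder P] (k : ℕ) (S : Set P) : Prop :=
  ∃ B : Fin k → Set P, (∀ i, IsAntichain (· ≤ ·) (B i)) ∧
    Pairwise (fun i j => Disjoint (B i) (B j)) ∧ ⋃ i, B i = S

/-- The width of a finite poset: the largest size of an antichain. -/
noncomputable def posetWidth (P : Type*) [PartialOrder P] [Finite P] : ℕ :=
  sSup {n : ℕ | ∃ S : Set P, IsAntichain (· ≤ ·) S ∧ S.ncard = n}

/-- `d_k(P)`: the largest size of a `k`-antichain of the finite poset `P`. -/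
noncomputable def maxKAntichain (P : Type*) [PartialOrder P] [Finite P] (k : ℕ) : ℕ :=
  sSup {n : ℕ | ∃ S : Set P, IsKAntichain k S ∧ S.ncard = n}

/-- The supremum defining the width is attained. -/
theorem posetWidth_isGreatest (P : Type*) [PartialOrder P] [Finite P] :
    IsGreatest {n : ℕ | ∃ S : Set P, IsAntichain (· ≤ ·) S ∧ S.ncard = n} (posetWidth P) := by
  have hb : BddAbove {n : ℕ | ∃ S : Set P, IsAntichain (· ≤ ·) S ∧ S.ncard = n} :=
    ⟨Nat.card P, by rintro n ⟨S, -, rfl⟩; exact Set.ncard_le_card S⟩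
  exact ⟨Nat.sSup_mem ⟨0, ∅, Set.pairwise_empty _, Set.ncard_empty P⟩ hb,
    fun n hn => le_csSup hb hn⟩

/-- The supremum defining `d_k(P)` is attained. -/
theorem maxKAntichain_isGreatest (P : Type*) [PartialOrder P] [Finite P] (k : ℕ) :
    IsGreatest {n : ℕ | ∃ S : Set P, IsKAntichain k S ∧ S.ncard = n} (maxKAntichain P k) := by
  have hb : BddAbove {n : ℕ | ∃ S : Set P, IsKAntichain k S ∧ S.ncard = n} :=
    ⟨Nat.card P, by rintro n ⟨S, -, rfl⟩; exact Set.ncard_le_card S⟩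
  refine ⟨Nat.sSup_mem ⟨0, ∅, ⟨fun _ => ∅, ?_, ?_, ?_⟩, Set.ncard_empty P⟩ hb,
    fun n hn => le_csSup hb hn⟩
  · exact fun _ => Set.pairwise_empty _
  · intro i j _
    exact disjoint_bot_left
  · simp

/-- A finite poset is `d`-decomposable if it has a partition `A₁, …, A_h` into nonempty
antichains such that `|A₁ ∪ … ∪ A_k| = d_k(P)` for every `k`
(blocks are indexed from `0`, so the first `k` blocks are those of index `i < k`). -/
def IsDDecomposable (P : Type*) [PartialOrder P] [Finite P] : Prop :=
  ∃ (h : ℕ) (A : Fin h → Set P),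
    (∀ i, (A i).Nonempty) ∧
    (∀ i, IsAntichain (· ≤ ·) (A i)) ∧
    Pairwise (fun i j => Disjoint (A i) (A j)) ∧
    ⋃ i, A i = Set.univ ∧
    ∀ k : ℕ, (⋃ i : {i : Fin h // (i : ℕ) < k}, A i).ncard = maxKAntichain P k

/-! The bound on `k`-antichains is dual: `k` antichains contain at most `k * c` elements of a union
of `c` chains, hence at most `k * c` plus the number of elements outside it. For width at most 3, it
suffices to have a partition into `C.card` antichains, `C` a longest chain, whose excess over pairs
is at least the number of elements outside an optimal pair of chains. Sorted by decreasing size, its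
first `m` blocks meet the bound with `c` the size of the next block: 1, 2 or 3.

To build it, let `w x` be the largest total size of two disjoint chains, the second below or equal
to `x`, and `w' x` the same with the second strictly below `x`. Exchanges with `C` show that `w' x <
w x` off `C` (`maxTwoChains_Iio_lt`) and that every value above `C.card`, up to the maximum `W`, is
reached by a jump at some element of `C` (`exists_jump`). Each `x` off `C` joins a jump element with
the same `w`. Only `W - C.card` blocks can then have more than one element, which bounds the excess.
-/

/-- `S` admits two disjoint chains, the second one inside `S`, of total size at least `v`. -/
def HasTwoChains {P : Type*} [PartialOrder P] (S : Set P) (v : ℕ) : Prop :=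
  ∃ D E : Finset P, IsChain (· ≤ ·) (D : Set P) ∧ IsChain (· ≤ ·) (E : Set P) ∧ Disjoint D E ∧
    (E : Set P) ⊆ S ∧ v ≤ D.card + E.card

/-- The largest total size of two disjoint chains, the second one inside `S`. -/
noncomputable def maxTwoChains {P : Type*} [PartialOrder P] (S : Set P) : ℕ :=
  sSup {v | HasTwoChains S v}

/-! ### Pairs of disjoint chains and exchanges with a longest chain -/

section TwoChains

variable {P : Type*} [PartialOrder P] [Fintype P]

theorem le_maxTwoChains_iff {S : Set P} {v : ℕ} : v ≤ maxTwoChains S ↔ HasTwoChains S v := by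
  classical
  have hb : BddAbove {v | HasTwoChains S v} := by
    refine ⟨Fintype.card P, ?_⟩
    rintro v ⟨D, E, -, -, hDE, -, hv⟩
    rw [← Finset.card_union_of_disjoint hDE] at hv
    exact hv.trans (Finset.card_le_univ _)
  constructor
  · intro h
    have hm : HasTwoChains S (maxTwoChains S) :=
      Nat.sSup_mem (s := {v | HasTwoChains S v})
        ⟨0, ∅, ∅, by simp, by simp, by simp, by simp, by simp⟩ hb
    obtain ⟨D, E, h1, h2, h3, h4, h5⟩ := hm
    exact ⟨D, E, h1, h2, h3, h4, h.trans h5⟩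
  · exact fun h => le_csSup hb h

theorem maxTwoChains_mono {S T : Set P} (h : S ⊆ T) : maxTwoChains S ≤ maxTwoChains T := by
  obtain ⟨D, E, h1, h2, h3, h4, h5⟩ := le_maxTwoChains_iff.1 (le_refl (maxTwoChains S))
  exact le_maxTwoChains_iff.2 ⟨D, E, h1, h2, h3, h4.trans h, h5⟩

theorem maxTwoChains_Iic_le (x : P) :
    maxTwoChains (Set.Iic x) ≤ maxTwoChains (Set.Iio x) + 1 := by
  classical
  obtain ⟨D, E, h1, h2, h3, h4, h5⟩ :=
    le_maxTwoChains_iff.1 (le_refl (maxTwoChains (Set.Iic x)))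
  have : maxTwoChains (Set.Iic x) - 1 ≤ maxTwoChains (Set.Iio x) := by
    refine le_maxTwoChains_iff.2 ⟨D, E.erase x, h1, h2.mono (by simp), ?_, ?_, ?_⟩
    · exact h3.mono_right (Finset.erase_subset _ _)
    · intro d hd
      have hd' := Finset.mem_erase.1 (Finset.mem_coe.1 hd)
      exact lt_of_le_of_ne (h4 hd'.2) hd'.1
    · have := Finset.pred_card_le_card_erase (s := E) (a := x)
      omega
  omega

omit [Fintype P] in
theorem isChain_filter {D : Finset P} (hD : IsChain (· ≤ ·) (D : Set P)) (p : P → Prop)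
    [DecidablePred p] : IsChain (· ≤ ·) ((D.filter p : Finset P) : Set P) :=
  hD.mono (Finset.coe_subset.2 (Finset.filter_subset p D))

omit [Fintype P] in
theorem isChain_union_of_lt [DecidableEq P] {A B : Finset P} (hA : IsChain (· ≤ ·) (A : Set P))
    (hB : IsChain (· ≤ ·) (B : Set P)) (h : ∀ a ∈ A, ∀ b ∈ B, a < b) :
    IsChain (· ≤ ·) ((A ∪ B : Finset P) : Set P) := by
  rw [Finset.coe_union]
  rintro a (ha | ha) b (hb | hb) hab
  · exact hA ha hb hab
  · exact Or.inl (h a ha b hb).le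
  · exact Or.inr (h b hb a ha).le
  · exact hB ha hb hab

omit [Fintype P] in
theorem card_union_of_lt [DecidableEq P] {A B : Finset P} (h : ∀ a ∈ A, ∀ b ∈ B, a < b) :
    (A ∪ B).card = A.card + B.card :=
  Finset.card_union_of_disjoint
    (Finset.disjoint_left.2 fun a ha hb => lt_irrefl a (h a ha a hb))

omit [Fintype P] in
/-- Splitting a chain at one of its elements. -/
theorem card_filter_le_add_filter_lt {D : Finset P} [DecidableLE P] [DecidableLT P]
    (hD : IsChain (· ≤ ·) (D : Set P)) {q : P} (hq : q ∈ D) :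
    D.card = (D.filter (· ≤ q)).card + (D.filter (q < ·)).card := by
  rw [← Finset.card_filter_add_card_filter_not (s := D) (· ≤ q)]
  congr 2
  ext d
  simp only [Finset.mem_filter, and_congr_right_iff]
  intro hd
  constructor
  · intro h
    rcases hD.total (Finset.mem_coe.2 hd) (Finset.mem_coe.2 hq) with h' | h'
    · exact absurd h' h
    · exact lt_of_le_not_ge h' h
  · exact fun h => not_le_of_gt h

omit [Fintype P] in
/-- A finite nonempty set of elements of a chain has a largest element. -/
theorem exists_max_of_isChain {Z : Finset P} (hZ : IsChain (· ≤ ·) (Z : Set P))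
    (hne : Z.Nonempty) : ∃ q ∈ Z, ∀ z ∈ Z, z ≤ q := by
  obtain ⟨q, hq, hm⟩ := Z.exists_maximal hne
  refine ⟨q, hq, fun z hz => ?_⟩
  rcases hZ.total (Finset.mem_coe.2 hz) (Finset.mem_coe.2 hq) with h | h
  · exact h
  · exact hm hz h

variable {C : Finset P} (hC : IsChain (· ≤ ·) (C : Set P))
  (hmax : ∀ D : Finset P, IsChain (· ≤ ·) (D : Set P) → D.card ≤ C.card)

include hC

theorem card_le_maxTwoChains (S : Set P) : C.card ≤ maxTwoChains S :=
  le_maxTwoChains_iff.2 ⟨C, ∅, hC, by simp, by simp, by simp, by simp⟩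

include hmax

omit [Fintype P] in
/-- In a longest chain, the part above `q` is at least as long as any chain above `q`. -/
theorem card_le_card_filter_lt [DecidableEq P] [DecidableLE P] [DecidableLT P] {q : P}
    (hq : q ∈ C) {D : Finset P} (hD : IsChain (· ≤ ·) (D : Set P)) (h : ∀ d ∈ D, q < d) :
    D.card ≤ (C.filter (q < ·)).card := by
  have hlt : ∀ a ∈ C.filter (· ≤ q), ∀ b ∈ D, a < b := fun a ha b hb =>
    lt_of_le_of_lt (Finset.mem_filter.1 ha).2 (h b hb)
  have := hmax _ (isChain_union_of_lt (isChain_filter hC _) hD hlt)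
  rw [card_union_of_lt hlt, card_filter_le_add_filter_lt hC hq] at this
  omega

-- Above `q`, the chain `D` can follow `C` instead without loss, since `C` is longest. The new chain
-- avoids `x`, so `x` can be put on top of `E`.
omit [Fintype P] in
theorem hasTwoChains_insert_aux {x : P} (hx : x ∉ C) {D E : Finset P}
    (hD : IsChain (· ≤ ·) (D : Set P)) (hE : IsChain (· ≤ ·) (E : Set P)) (hDE : Disjoint D E)
    (hEx : ∀ e ∈ E, e < x) {q : P} (hqC : q ∈ C) (hqD : q ∈ D) (hqx : q < x)
    (hq : ∀ e ∈ E, e ∈ C → e ≤ q) : HasTwoChains (Set.Iic x) (D.card + E.card + 1) := by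
  classical
  have hlt : ∀ a ∈ D.filter (· ≤ q), ∀ b ∈ C.filter (q < ·), a < b := fun a ha b hb =>
    lt_of_le_of_lt (Finset.mem_filter.1 ha).2 (Finset.mem_filter.1 hb).2
  have hlt' : ∀ a ∈ E, ∀ b ∈ ({x} : Finset P), a < b := by simpa using hEx
  refine ⟨D.filter (· ≤ q) ∪ C.filter (q < ·), E ∪ {x},
    isChain_union_of_lt (isChain_filter hD _) (isChain_filter hC _) hlt,
    isChain_union_of_lt hE (by simp) hlt', ?_, ?_, ?_⟩
  · rw [Finset.disjoint_left]
    intro a ha hb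
    simp only [Finset.mem_union, Finset.mem_filter, Finset.mem_singleton] at ha hb
    rcases hb with hb | rfl
    · rcases ha with ha | ha
      · exact Finset.disjoint_left.1 hDE ha.1 hb
      · exact absurd (hq a hb ha.1) (not_le_of_gt ha.2)
    · rcases ha with ha | ha
      · exact absurd ha.2 (not_le_of_gt hqx)
      · exact hx ha.1
  · intro e he
    simp only [Finset.coe_union, Finset.coe_singleton, Set.mem_union, Finset.mem_coe,
      Set.mem_singleton_iff] at he
    rcases he with he | rfl
    · exact (hEx e he).le
    · exact le_rfl
  · rw [card_union_of_lt hlt, card_union_of_lt hlt', card_filter_le_add_filter_lt hD hqD]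
    have := card_le_card_filter_lt hC hmax hqC (D := D.filter (q < ·)) (isChain_filter hD _)
      (by simp)
    simp only [Finset.card_singleton]
    omega

/-- Outside a longest chain, allowing the element `x` itself gains one. -/
theorem maxTwoChains_Iio_lt {x : P} (hx : x ∉ C) :
    maxTwoChains (Set.Iio x) + 1 ≤ maxTwoChains (Set.Iic x) := by
  classical
  obtain ⟨D, E, hD, hE, hDE, hEx, hv⟩ :=
    le_maxTwoChains_iff.1 (le_refl (maxTwoChains (Set.Iio x)))
  refine le_trans (Nat.add_le_add_right hv 1) (le_maxTwoChains_iff.2 ?_)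
  have hlt' : ∀ a ∈ E, ∀ b ∈ ({x} : Finset P), a < b := by simpa using fun e he => hEx he
  have hsub : ((E ∪ {x} : Finset P) : Set P) ⊆ Set.Iic x := by
    intro e he
    simp only [Finset.coe_union, Finset.coe_singleton, Set.mem_union, Finset.mem_coe,
      Set.mem_singleton_iff] at he
    rcases he with he | rfl
    · exact le_of_lt (hEx he)
    · exact le_rfl
  by_cases hxD : x ∈ D
  swap
  · refine ⟨D, E ∪ {x}, hD, isChain_union_of_lt hE (by simp) hlt', ?_, hsub, ?_⟩
    · simp [hDE, hxD]
    · rw [card_union_of_lt hlt', Finset.card_singleton]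
      omega
  by_cases hZ : (C.filter fun c => (c ∈ D ∧ c < x) ∨ c ∈ E).Nonempty
  · obtain ⟨q, hq, hqmax⟩ := exists_max_of_isChain (isChain_filter hC _) hZ
    simp only [Finset.mem_filter] at hq hqmax
    obtain ⟨hqC, ⟨hqD, hqx⟩ | hqE⟩ := hq
    · exact hasTwoChains_insert_aux hC hmax hx hD hE hDE (fun e he => hEx he) hqC hqD hqx
        fun e he heC => hqmax e ⟨heC, Or.inr he⟩
    -- Swap the parts of the two chains below `x`: `E` continues into the part of `D` from `x` on.
    -- Now `q` lies in the first chain.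
    · have hlt : ∀ a ∈ E, ∀ b ∈ D.filter (x ≤ ·), a < b := fun a ha b hb =>
        lt_of_lt_of_le (hEx ha) (Finset.mem_filter.1 hb).2
      have key := hasTwoChains_insert_aux hC hmax hx (D := E ∪ D.filter (x ≤ ·))
        (E := D.filter (· < x)) (isChain_union_of_lt hE (isChain_filter hD _) hlt)
        (isChain_filter hD _) ?_ (by simp) hqC (by simp [hqE]) (hEx hqE)
        (fun e he heC => hqmax e ⟨heC, Or.inl (by simpa using he)⟩)
      · rw [card_union_of_lt hlt] at key
        have hs : D.card = (D.filter (· < x)).card + (D.filter (x ≤ ·)).card := by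
          rw [← Finset.card_filter_add_card_filter_not (s := D) (· < x)]
          congr 2
          ext d
          simp only [Finset.mem_filter, and_congr_right_iff]
          intro hd
          constructor
          · intro h
            rcases hD.total (Finset.mem_coe.2 hd) (Finset.mem_coe.2 hxD) with h' | h'
            · exact (eq_of_le_of_not_lt h' h).ge
            · exact h'
          · exact fun h => not_lt_of_ge h
        rw [hs]
        convert key using 1
        omega
      · rw [Finset.disjoint_left]
        intro a ha hb
        simp only [Finset.mem_union, Finset.mem_filter] at ha hb
        rcases ha with ha | ha
        · exact Finset.disjoint_left.1 hDE hb.1 ha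
        · exact absurd hb.2 (not_lt_of_ge ha.2)
  · rw [Finset.not_nonempty_iff_eq_empty, Finset.filter_eq_empty_iff] at hZ
    -- `C` misses `E` and is at least as long as `D`, so it replaces `D`.
    refine ⟨C, E ∪ {x}, hC, isChain_union_of_lt hE (by simp) hlt', ?_, hsub, ?_⟩
    · rw [Finset.disjoint_left]
      intro a ha hb
      simp only [Finset.mem_union, Finset.mem_singleton] at hb
      rcases hb with hb | rfl
      · exact hZ ha (Or.inr hb)
      · exact hx ha
    · rw [card_union_of_lt hlt', Finset.card_singleton]
      have := hmax D hD
      omega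

omit [Fintype P] in
/-- If the second chain lies below the upper part `U` of a longest chain, then the two chains
can be replaced so that the second one lies below the complementary lower part. -/
theorem HasTwoChains.exists_le_of_cut {U L : Finset P} {v : ℕ}
    (hUL : ∀ c, c ∈ C ↔ c ∈ L ∨ c ∈ U) (hLU : ∀ a ∈ L, ∀ b ∈ U, a < b)
    (h : HasTwoChains {d | ∀ u ∈ U, d < u} v) :
    HasTwoChains {d | ∃ c ∈ L, d ≤ c} v := by
  classical
  obtain ⟨D, E, hD, hE, hDE, hEU, hv⟩ := h
  have hEU' : ∀ a ∈ E, ∀ b ∈ U, a < b := fun a ha => hEU ha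
  have hCLU : C = L ∪ U := by ext c; simp [hUL]
  have hLc : IsChain (· ≤ ·) (L : Set P) := hC.mono fun c hc => (hUL c).2 (Or.inl hc)
  have hUc : IsChain (· ≤ ·) (U : Set P) := hC.mono fun c hc => (hUL c).2 (Or.inr hc)
  have hcard : C.card = L.card + U.card := by rw [hCLU, card_union_of_lt hLU]
  by_cases hZ : (L.filter fun c => c ∈ D ∨ c ∈ E).Nonempty
  · obtain ⟨q, hq, hqmax⟩ := exists_max_of_isChain (isChain_filter hLc _) hZ
    simp only [Finset.mem_filter] at hq hqmax
    have hqL := hq.1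
    have hqC : q ∈ C := (hUL q).2 (Or.inl hqL)
    have hup : (C.filter (q < ·)).card = (L.filter (q < ·)).card + U.card := by
      rw [← card_union_of_lt (fun a ha b hb => hLU a (Finset.mem_filter.1 ha).1 b hb), hCLU,
        Finset.filter_union, Finset.filter_true_of_mem (s := U) (fun b hb => hLU q hqL b hb)]
    have hlt : ∀ F : Finset P, ∀ a ∈ F.filter (· ≤ q), ∀ b ∈ L.filter (q < ·), a < b :=
      fun F a ha b hb => lt_of_le_of_lt (Finset.mem_filter.1 ha).2 (Finset.mem_filter.1 hb).2
    have hsub : ∀ F : Finset P, ((F.filter (· ≤ q) ∪ L.filter (q < ·) : Finset P) : Set P) ⊆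
        {d | ∃ c ∈ L, d ≤ c} := by
      intro F d hd
      simp only [Finset.mem_coe, Finset.mem_union, Finset.mem_filter] at hd
      rcases hd with hd | hd
      · exact ⟨q, hqL, hd.2⟩
      · exact ⟨d, hd.1, le_rfl⟩
    rcases hq.2 with hqD | hqE
    -- The chains swap roles: `E` gains `U`, and `D` above `q` is traded for the rest of `L`. The
    -- loss is at most the part of `C` above `q`, which is exactly the gain.
    · refine ⟨E ∪ U, D.filter (· ≤ q) ∪ L.filter (q < ·), isChain_union_of_lt hE hUc hEU',
        isChain_union_of_lt (isChain_filter hD _) (isChain_filter hLc _) (hlt D), ?_, hsub D, ?_⟩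
      · rw [Finset.disjoint_left]
        intro a ha hb
        simp only [Finset.mem_union, Finset.mem_filter] at ha hb
        rcases hb with hb | hb
        · rcases ha with ha | ha
          · exact Finset.disjoint_left.1 hDE hb.1 ha
          · exact absurd hb.2 (not_le_of_gt (hLU q hqL a ha))
        · rcases ha with ha | ha
          · exact absurd (hqmax a ⟨hb.1, Or.inr ha⟩) (not_le_of_gt hb.2)
          · exact lt_irrefl a (hLU a hb.1 a ha)
      · rw [card_union_of_lt hEU', card_union_of_lt (hlt D)]
        have h1 := card_filter_le_add_filter_lt hD hqD
        have h2 := card_le_card_filter_lt hC hmax hqC (D := D.filter (q < ·))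
          (isChain_filter hD _) (by simp)
        omega
    · refine ⟨D, E.filter (· ≤ q) ∪ L.filter (q < ·), hD,
        isChain_union_of_lt (isChain_filter hE _) (isChain_filter hLc _) (hlt E), ?_, hsub E, ?_⟩
      · rw [Finset.disjoint_left]
        intro a ha hb
        simp only [Finset.mem_union, Finset.mem_filter] at hb
        rcases hb with hb | hb
        · exact Finset.disjoint_left.1 hDE ha hb.1
        · exact absurd (hqmax a ⟨hb.1, Or.inl ha⟩) (not_le_of_gt hb.2)
      · rw [card_union_of_lt (hlt E)]
        have h1 := card_filter_le_add_filter_lt hE hqE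
        have hlt2 : ∀ a ∈ E.filter (q < ·), ∀ b ∈ U, a < b := fun a ha b hb =>
          hEU' a (Finset.mem_filter.1 ha).1 b hb
        have h2 := card_le_card_filter_lt hC hmax hqC (D := E.filter (q < ·) ∪ U)
          (isChain_union_of_lt (isChain_filter hE _) hUc hlt2) (by
            intro d hd
            simp only [Finset.mem_union, Finset.mem_filter] at hd
            rcases hd with hd | hd
            · exact hd.2
            · exact hLU q hqL d hd)
        rw [card_union_of_lt hlt2] at h2
        omega
  · rw [Finset.not_nonempty_iff_eq_empty, Finset.filter_eq_empty_iff] at hZ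
    -- Neither chain meets `L`, and `E ∪ U` is a chain, so `L` is at least as long as `E`.
    refine ⟨D, L, hD, hLc, ?_, fun d hd => ⟨d, hd, le_rfl⟩, ?_⟩
    · rw [Finset.disjoint_left]
      exact fun a ha hb => hZ hb (Or.inl ha)
    · have := hmax _ (isChain_union_of_lt hE hUc hEU')
      rw [card_union_of_lt hEU'] at this
      omega

/-- Past the length of a longest chain, a value reached below the upper part of a cut of that
chain is reached below some element of the lower part. -/
theorem exists_le_maxTwoChains_Iic_of_cut {U L : Finset P} {v : ℕ} (hv : C.card < v)
    (hUL : ∀ c, c ∈ C ↔ c ∈ L ∨ c ∈ U) (hLU : ∀ a ∈ L, ∀ b ∈ U, a < b)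
    (h : v ≤ maxTwoChains {d | ∀ u ∈ U, d < u}) :
    ∃ c ∈ L, v ≤ maxTwoChains (Set.Iic c) := by
  obtain ⟨D, E, hD, hE, hDE, hEL, hvDE⟩ :=
    (le_maxTwoChains_iff.1 h).exists_le_of_cut hC hmax hUL hLU
  have hne : L.Nonempty := by
    by_contra hne
    rw [Finset.not_nonempty_iff_eq_empty] at hne
    have hE0 : E = ∅ := by
      rw [Finset.eq_empty_iff_forall_notMem]
      intro e he
      obtain ⟨c, hc, -⟩ := hEL he
      simp [hne] at hc
    have := hmax D hD
    simp [hE0] at hvDE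
    omega
  obtain ⟨c, hc, hcmax⟩ := exists_max_of_isChain
    (hC.mono fun c hc => (hUL c).2 (Or.inl hc)) hne
  refine ⟨c, hc, le_maxTwoChains_iff.2 ⟨D, E, hD, hE, hDE, ?_, hvDE⟩⟩
  intro e he
  obtain ⟨c', hc', h'⟩ := hEL he
  exact le_trans h' (hcmax c' hc')

/-- Every value between the length of a longest chain and the largest size of two disjoint
chains is attained at a jump along the longest chain. -/
theorem exists_jump {v : ℕ} (hv : C.card < v) (hv' : v ≤ maxTwoChains (Set.univ : Set P)) :
    ∃ c ∈ C, maxTwoChains (Set.Iic c) = v ∧ maxTwoChains (Set.Iio c) < v := by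
  classical
  have hne : (C.filter fun c => v ≤ maxTwoChains (Set.Iic c)).Nonempty := by
    obtain ⟨c, hc, h⟩ := exists_le_maxTwoChains_Iic_of_cut hC hmax (U := ∅) (L := C) hv
      (by simp) (by simp) (by simpa using hv')
    exact ⟨c, by simp [hc, h]⟩
  obtain ⟨c, hc, hmin⟩ := Finset.exists_minimal hne
  simp only [Finset.mem_filter] at hc hmin
  -- Otherwise cutting `C` just below `c` yields a smaller element of `C` that reaches `v`.
  have hlt : maxTwoChains (Set.Iio c) < v := by
    by_contra! hge
    obtain ⟨c', hc', h⟩ := exists_le_maxTwoChains_Iic_of_cut hC hmax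
      (U := C.filter (c ≤ ·)) (L := C.filter (· < c)) hv
      (by
        intro d
        simp only [Finset.mem_filter, ← and_or_left]
        refine ⟨fun hd => ⟨hd, ?_⟩, fun hd => hd.1⟩
        rcases hC.total (Finset.mem_coe.2 hd) (Finset.mem_coe.2 hc.1) with h | h
        · exact h.lt_or_eq.imp id fun e => e.ge
        · exact Or.inr h)
      (fun a ha b hb => lt_of_lt_of_le (Finset.mem_filter.1 ha).2 (Finset.mem_filter.1 hb).2)
      (hge.trans (maxTwoChains_mono fun d hd u hu =>
        lt_of_lt_of_le hd (Finset.mem_filter.1 hu).2))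
    simp only [Finset.mem_filter] at hc'
    exact absurd (hmin ⟨hc'.1, h⟩ hc'.2.le) (not_le_of_gt hc'.2)
  refine ⟨c, hc.1, le_antisymm ?_ hc.2, hlt⟩
  have := maxTwoChains_Iic_le c
  omega

end TwoChains

section Partition

variable {P : Type*} [PartialOrder P] [Fintype P]

/-- A finite poset has a partition into as many antichains as a longest chain has elements,
in which the excess over pairs is at least the number of elements outside any two chains. -/
theorem exists_partition_sum_sub_two {C : Finset P} (hC : IsChain (· ≤ ·) (C : Set P))
    (hmax : ∀ D : Finset P, IsChain (· ≤ ·) (D : Set P) → D.card ≤ C.card) :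
    ∃ g : P → Fin C.card, Function.Surjective g ∧
      (∀ i, IsAntichain (· ≤ ·) {x | g x = i}) ∧
      Fintype.card P ≤ maxTwoChains (Set.univ : Set P) +
        ∑ i, ((Finset.univ.filter fun x => g x = i).card - 2) := by
  classical
  rcases isEmpty_or_nonempty P with hP | hP
  · have hC0 : C.card = 0 := by simp [Finset.eq_empty_of_isEmpty C]
    exact ⟨isEmptyElim, fun i => absurd i.2 (by omega), fun i x => isEmptyElim x, by simp⟩
  set w : P → ℕ := fun x => maxTwoChains (Set.Iic x) with hw
  set w' : P → ℕ := fun x => maxTwoChains (Set.Iio x) with hw'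
  set W := maxTwoChains (Set.univ : Set P) with hW
  have hwW : ∀ x, w x ≤ W := fun x => maxTwoChains_mono (Set.subset_univ _)
  have hlow : ∀ x, C.card ≤ w' x := fun x => card_le_maxTwoChains hC _
  have hoff : ∀ x, x ∉ C → w' x < w x := fun x hx => maxTwoChains_Iio_lt hC hmax hx
  have hlt : ∀ x y, x < y → w x ≤ w' y := fun x y h =>
    maxTwoChains_mono fun d hd => lt_of_le_of_lt hd h
  have hjump : ∀ v, C.card < v ∧ v ≤ W → ∃ c ∈ C, w c = v ∧ w' c < v := fun v hv =>
    exists_jump hC hmax hv.1 hv.2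
  choose! c hc using hjump
  set g₀ : P → P := fun x => if x ∈ C then x else c (w x) with hg₀
  have hoffc : ∀ x, x ∉ C → c (w x) ∈ C ∧ w (c (w x)) = w x ∧ w' (c (w x)) < w x := fun x hx =>
    hc (w x) ⟨lt_of_le_of_lt (hlow x) (hoff x hx), hwW x⟩
  have hg₀C : ∀ x, g₀ x ∈ C := by
    intro x
    by_cases hx : x ∈ C
    · simp [hg₀, hx]
    · simpa [hg₀, hx] using (hoffc x hx).1
  have hg₀w : ∀ x, w (g₀ x) = w x := by
    intro x
    by_cases hx : x ∈ C
    · simp [hg₀, hx]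
    · simpa [hg₀, hx] using (hoffc x hx).2.1
  -- In a common fiber `w x = w y`, so `w y ≤ w' y` and `y` is not a jump. But elements off `C` and
  -- chosen representatives are jumps.
  have hfiber : ∀ x y, x < y → g₀ x ≠ g₀ y := by
    intro x y hxy h
    have hwxy : w x = w y := by rw [← hg₀w x, h, hg₀w y]
    have h1 := hlt x y hxy
    by_cases hy : y ∈ C
    · by_cases hx : x ∈ C
      · simp only [hg₀, hx, hy, if_true] at h
        exact hxy.ne h
      · simp only [hg₀, hx, hy, if_true, if_false] at h
        have := (hoffc x hx).2.2
        rw [h] at this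
        omega
    · have := hoff y hy
      omega
  let e := C.equivFin
  let g : P → Fin C.card := fun x => e ⟨g₀ x, hg₀C x⟩
  have hge : ∀ x (p : C), g x = e p ↔ g₀ x = p := by
    intro x p
    simp only [g, EmbeddingLike.apply_eq_iff_eq]
    exact Subtype.ext_iff
  refine ⟨g, ?_, ?_, ?_⟩
  · intro i
    refine ⟨(e.symm i : P), ?_⟩
    rw [← e.apply_symm_apply i, hge]
    simp [hg₀]
  · intro i x hx y hy hxy hle
    have : g x = g y := Eq.trans hx (Eq.symm hy)
    simp only [g, EmbeddingLike.apply_eq_iff_eq, Subtype.mk.injEq] at this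
    exact hfiber x y (lt_of_le_of_ne hle hxy) this
  · have hsum : ∑ i, ((Finset.univ.filter fun x => g x = i).card - 2) =
        ∑ p ∈ C, ((Finset.univ.filter fun x => g₀ x = p).card - 2) := by
      rw [← Finset.sum_coe_sort C, ← Equiv.sum_comp e]
      refine Finset.sum_congr rfl fun p _ => ?_
      simp only [hge]
    rw [hsum]
    set J := (Finset.Ioc C.card W).image c with hJ
    have hJcard : J.card ≤ W - C.card := by
      simpa using Finset.card_image_le (s := Finset.Ioc C.card W) (f := c)
    -- Only chosen jump elements, those in `J`, receive elements from off `C`.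
    have hpoint : ∀ p ∈ C, (Finset.univ.filter fun x => g₀ x = p).card ≤
        1 + ((Finset.univ.filter fun x => g₀ x = p).card - 2) + if p ∈ J then 1 else 0 := by
      intro p hp
      by_cases hpJ : p ∈ J
      · rw [if_pos hpJ]
        omega
      · have : (Finset.univ.filter fun x => g₀ x = p) ⊆ {p} := by
          intro x hx
          simp only [Finset.mem_filter, Finset.mem_univ, true_and] at hx
          by_cases hxC : x ∈ C
          · simpa [hg₀, hxC] using hx
          · refine absurd ?_ hpJ
            simp only [hg₀, hxC, if_false] at hx
            exact Finset.mem_image.2 ⟨w x, Finset.mem_Ioc.2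
              ⟨lt_of_le_of_lt (hlow x) (hoff x hxC), hwW x⟩, hx⟩
        have := Finset.card_le_card this
        rw [Finset.card_singleton] at this
        omega
    have hcard : Fintype.card P = ∑ p ∈ C, (Finset.univ.filter fun x => g₀ x = p).card :=
      Finset.card_eq_sum_card_fiberwise fun x _ => hg₀C x
    have := Finset.sum_le_sum hpoint
    rw [← hcard, Finset.sum_add_distrib, Finset.sum_add_distrib, Finset.sum_const,
      Finset.sum_boole] at this
    have hJ' : (C.filter (· ∈ J)).card ≤ J.card :=
      Finset.card_le_card fun x hx => (Finset.mem_filter.1 hx).2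
    have hCW : C.card ≤ W := card_le_maxTwoChains hC _
    simp only [smul_eq_mul, mul_one, Nat.cast_id] at this
    omega

end Partition

/-! ### Duality bound and the sorted partition -/

/-- A set whose intersection with every antichain has at most `c` elements bounds the size of
`k`-antichains. -/
theorem IsKAntichain.ncard_le {P : Type*} [PartialOrder P] [Finite P] {k c : ℕ} {S T : Set P}
    (hS : IsKAntichain k S)
    (hT : ∀ A : Set P, IsAntichain (· ≤ ·) A → (A ∩ T).ncard ≤ c) :
    S.ncard ≤ k * c + Tᶜ.ncard := by
  obtain ⟨B, hB, -, rfl⟩ := hS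
  have h1 : ((⋃ i, B i) ∩ T).ncard ≤ k * c := by
    rw [Set.iUnion_inter]
    refine (Set.ncard_iUnion_le_of_fintype _).trans ?_
    simpa using Finset.sum_le_card_nsmul Finset.univ (fun i => (B i ∩ T).ncard) c
      fun i _ => hT _ (hB i)
  have h2 : ((⋃ i, B i) \ T).ncard ≤ Tᶜ.ncard := Set.ncard_le_ncard fun x hx => hx.2
  rw [← Set.ncard_inter_add_ncard_sdiff_eq_ncard (⋃ i, B i) T]
  exact add_le_add h1 h2

theorem ncard_inter_le_one_of_isChain {P : Type*} [PartialOrder P] [Finite P] {A D : Set P}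
    (hA : IsAntichain (· ≤ ·) A) (hD : IsChain (· ≤ ·) D) : (A ∩ D).ncard ≤ 1 :=
  Set.ncard_le_one_iff_subsingleton.2 (inter_subsingleton_of_isAntichain_of_isChain hA hD)

/-- A decreasing sequence has its first `m` terms summing to `m` times the `m`-th term plus the
total excess over that term. -/
theorem sum_filter_lt_eq_of_antitone {h : ℕ} {φ : Fin h → ℕ} (hφ : Antitone φ) (m : Fin h) :
    ∑ i ∈ Finset.univ.filter (· < m), φ i = m * φ m + ∑ i, (φ i - φ m) := by
  have h1 : ∑ i ∈ Finset.univ.filter (· < m), (φ i - φ m) = ∑ i, (φ i - φ m) := by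
    refine Finset.sum_subset (Finset.subset_univ _) fun i _ hi => ?_
    have : m ≤ i := by simpa using hi
    exact Nat.sub_eq_zero_of_le (hφ this)
  have h2 : ∑ i ∈ Finset.univ.filter (· < m), φ i =
      ∑ i ∈ Finset.univ.filter (· < m), (φ m + (φ i - φ m)) := by
    refine Finset.sum_congr rfl fun i hi => ?_
    have := hφ (Finset.mem_filter.1 hi).2.le
    omega
  rw [h2, Finset.sum_add_distrib, h1, Finset.sum_const, smul_eq_mul, Finset.filter_gt_eq_Iio,
    Fin.card_Iio]

theorem mainTheorem7 (P : Type*) [PartialOrder P] [Finite P] (hP : posetWidth P ≤ 3) :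
    IsDDecomposable P := by
  classical
  have := Fintype.ofFinite P
  obtain ⟨C, hCmem, hCmax⟩ := Finset.exists_max_image
    (Finset.univ.filter fun D : Finset P => IsChain (· ≤ ·) (D : Set P)) Finset.card
    ⟨∅, by simp⟩
  have hC : IsChain (· ≤ ·) (C : Set P) := (Finset.mem_filter.1 hCmem).2
  have hmax : ∀ D : Finset P, IsChain (· ≤ ·) (D : Set P) → D.card ≤ C.card := fun D hD =>
    hCmax D (by simpa using hD)
  obtain ⟨g₁, hsurj, hanti, hcard⟩ := exists_partition_sum_sub_two hC hmax
  -- The order dual makes the sort decreasing in block size.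
  let σ := Tuple.sort fun i =>
    OrderDual.toDual (Finset.univ.filter fun x => g₁ x = i).card
  let g : P → Fin C.card := fun x => σ.symm (g₁ x)
  have hg : ∀ x i, g x = i ↔ g₁ x = σ i := fun x i => Equiv.symm_apply_eq σ
  let φ : Fin C.card → ℕ := fun i => (Finset.univ.filter fun x => g x = i).card
  have hφσ : ∀ i, φ i = (Finset.univ.filter fun x => g₁ x = σ i).card := by
    intro i
    simp only [φ, hg]
  have hφ : Antitone φ := by
    intro i j hij
    rw [hφσ, hφσ]
    exact OrderDual.toDual_le_toDual.1
      (Tuple.monotone_sort (fun i =>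
        OrderDual.toDual (Finset.univ.filter fun x => g₁ x = i).card) hij)
  have hA : ∀ i, IsAntichain (· ≤ ·) {x | g x = i} := by
    intro i
    simpa only [hg] using hanti (σ i)
  have hwidth : ∀ A : Set P, IsAntichain (· ≤ ·) A → A.ncard ≤ 3 := fun A hA =>
    ((posetWidth_isGreatest P).2 ⟨A, hA, rfl⟩).trans hP
  have hφ3 : ∀ i, φ i ≤ 3 := by
    intro i
    have := hwidth _ (hA i)
    rwa [Set.ncard_eq_toFinset_card', Set.toFinset_ofPred] at this
  have hne : ∀ i, ({x | g x = i} : Set P).Nonempty := by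
    intro i
    obtain ⟨x, hx⟩ := hsurj (σ i)
    exact ⟨x, (hg x i).2 hx⟩
  have hφ1 : ∀ i, 1 ≤ φ i := by
    intro i
    obtain ⟨x, hx⟩ := hne i
    exact Finset.card_pos.2 ⟨x, by simpa using hx⟩
  have hsum : Fintype.card P = ∑ i, φ i :=
    Finset.card_eq_sum_card_fiberwise fun x _ => Finset.mem_coe.2 (Finset.mem_univ _)
  have hdisj : Pairwise fun i j => Disjoint {x | g x = i} {x | g x = j} := by
    intro i j hij
    rw [Set.disjoint_left]
    rintro x rfl hx
    exact hij hx
  refine ⟨C.card, fun i => {x | g x = i}, hne, hA, hdisj, ?_, ?_⟩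
  · ext x
    simp
  intro m
  obtain ⟨⟨S, hS, hSm⟩, hub⟩ := maxKAntichain_isGreatest P m
  have hset : (⋃ i : {i : Fin C.card // (i : ℕ) < m}, {x | g x = i}) =
      {x | (g x : ℕ) < m} := by
    ext x
    simp
  rw [hset]
  refine le_antisymm (hub ⟨_, ⟨fun i => {x | (g x : ℕ) = i}, ?_, ?_, ?_⟩, rfl⟩) ?_
  · intro i x hx y hy
    exact hA (g x) rfl (Fin.ext (Eq.trans hy (Eq.symm hx)))
  · intro i j hij
    rw [Set.disjoint_left]
    intro x hx hx'
    exact hij (Fin.ext (Eq.trans (Eq.symm hx) hx'))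
  · ext x
    simp only [Set.mem_iUnion, Set.mem_ofPred_eq]
    exact ⟨fun ⟨i, hi⟩ => hi ▸ i.2, fun hx => ⟨⟨g x, hx⟩, rfl⟩⟩
  rw [← hSm]
  by_cases hm : m < C.card
  swap
  · have : {x | (g x : ℕ) < m} = Set.univ := by
      ext x
      simp only [Set.mem_ofPred_eq, Set.mem_univ, iff_true]
      omega
    rw [this]
    exact Set.ncard_le_ncard (Set.subset_univ _)
  have hcount : ({x | (g x : ℕ) < m} : Set P).ncard = m * φ ⟨m, hm⟩ +
      ∑ i, (φ i - φ ⟨m, hm⟩) := by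
    rw [← sum_filter_lt_eq_of_antitone hφ ⟨m, hm⟩, Set.ncard_eq_toFinset_card',
      Set.toFinset_ofPred, Finset.card_eq_sum_card_fiberwise
        (f := g) (t := Finset.univ.filter (· < (⟨m, hm⟩ : Fin C.card)))
        (fun x hx => by simpa [Fin.lt_def] using hx)]
    refine Finset.sum_congr rfl fun i hi => ?_
    congr 1
    ext x
    simp only [Finset.mem_filter, Finset.mem_univ, true_and, Fin.lt_def] at hi ⊢
    constructor
    · exact fun h => h.2
    · rintro rfl
      exact ⟨hi, rfl⟩
  rw [hcount]
  have hcases : φ ⟨m, hm⟩ = 1 ∨ φ ⟨m, hm⟩ = 2 ∨ φ ⟨m, hm⟩ = 3 := by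
    have h1 := hφ1 ⟨m, hm⟩
    have h3 := hφ3 ⟨m, hm⟩
    omega
  have hcompl : ∀ T : Finset P, ((T : Set P)ᶜ).ncard = Fintype.card P - T.card := by
    intro T
    rw [← Finset.coe_compl, Set.ncard_coe_finset, Finset.card_compl]
  -- The dual witnesses are `C`, an optimal pair of chains, and all of `P`.
  rcases hcases with h | h | h <;> rw [h]
  · have hb := hS.ncard_le (T := (C : Set P)) (c := 1)
      fun A hA => ncard_inter_le_one_of_isChain hA hC
    have h1 : ∑ i, φ i = ∑ i, (φ i - 1) + C.card := by
      have h2 : ∑ i, φ i = ∑ i, (φ i - 1 + 1) :=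
        Finset.sum_congr rfl fun i _ => (Nat.sub_add_cancel (hφ1 i)).symm
      rw [h2, Finset.sum_add_distrib]
      simp
    rw [hcompl] at hb
    omega
  · obtain ⟨D, E, hD, hE, hDE, -, hv⟩ :=
      le_maxTwoChains_iff.1 (le_refl (maxTwoChains (Set.univ : Set P)))
    have hb := hS.ncard_le (T := ((D ∪ E : Finset P) : Set P)) (c := 2) fun A hA => by
      rw [Finset.coe_union, Set.inter_union_distrib_left]
      exact (Set.ncard_union_le _ _).trans (Nat.add_le_add
        (ncard_inter_le_one_of_isChain hA hD) (ncard_inter_le_one_of_isChain hA hE))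
    have h2 : ∑ i, ((Finset.univ.filter fun x => g₁ x = i).card - 2) = ∑ i, (φ i - 2) := by
      simp only [hφσ]
      exact (Equiv.sum_comp σ fun i => (Finset.univ.filter fun x => g₁ x = i).card - 2).symm
    rw [hcompl, Finset.card_union_of_disjoint hDE] at hb
    omega
  · have hb := hS.ncard_le (T := Set.univ) (c := 3) fun A hA => by
      rw [Set.inter_univ]
      exact hwidth A hA
    simp only [Set.compl_univ, Set.ncard_empty] at hb
    omega
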